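/- Let $\mathbb{K}$ be a field of characteristic zero, let $S=\mathbb{K}[x_1,\dots,x_n]$ with the standard grading ($\deg x_i=1$), and let $I\subset S$ be an ideal (not necessarily monomial) generated by forms of a single degree $d$ such that $S/I$ is artinian. Let $\beta_{i,j}(S/I)$ denote the graded Betti numbers of $S/I$, i.e. the minimal graded free resolution of $S/I$ over $S$ has $i$-th term $F_i=\bigoplus_j S(-j)^{\beta_{i,j}(S/I)}$. Suppose that $S/I$ has an almost linear resolution, i.e. $\beta_{i,i+j}(S/I)=0$ for all $1\le i\le n-1$ and all $j\ge d$. Then $S/I$ has the weak Lefschetz property: there is a linear form $\ell\in (S/I)_1$ such that for every integer $j$ the multiplication map $\times\ell:(S/I)_j\to (S/I)_{j+1}$ is injective or surjective. -/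

import Mathlib

namespace LefschetzAlmostLinear

variable {K : Type*} [Field K] {n : ℕ}

/-- The degree `j` part `S_j` (`j ∈ ℤ`) of the standard graded polynomial ring
`S = K[x_1, …, x_n]`: all variables have degree `1`, and `S_j = 0` for `j < 0`. -/
noncomputable def polyPart (K : Type*) [Field K] (n : ℕ) (j : ℤ) : Submodule K (MvPolynomial (Fin n) K) :=
  MvPolynomial.weightedHomogeneousSubmodule K (fun _ : Fin n => (1 : ℤ)) j

/-- The degree `j` part `(S/I)_j` of `S/I`: the classes of the forms of degree `j`. -/
noncomputable def quotPart (I : Ideal (MvPolynomial (Fin n) K)) (j : ℤ) :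
    Submodule K (MvPolynomial (Fin n) K ⧸ I) :=
  (polyPart K n j).map (Ideal.Quotient.mkₐ K I).toLinearMap

theorem mul_mem_quotPart (I : Ideal (MvPolynomial (Fin n) K))
    {l : MvPolynomial (Fin n) K ⧸ I} (hl : l ∈ quotPart I 1) (j : ℤ) :
    ∀ a ∈ quotPart I j, LinearMap.mulLeft K l a ∈ quotPart I (j + 1) := by
  rintro _ ⟨a, ha, rfl⟩
  obtain ⟨b, hb, rfl⟩ := hl
  refine ⟨b * a, ?_, by simp⟩
  have h := MvPolynomial.IsWeightedHomogeneous.mul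
    ((MvPolynomial.mem_weightedHomogeneousSubmodule _ _ _ _).1 hb)
    ((MvPolynomial.mem_weightedHomogeneousSubmodule _ _ _ _).1 ha)
  rw [add_comm] at h
  exact h

/-- Multiplication by a linear form `ℓ ∈ (S/I)_1`, as a `K`-linear map
`(S/I)_j → (S/I)_{j+1}`. -/
noncomputable def timesLinear (I : Ideal (MvPolynomial (Fin n) K))
    (l : MvPolynomial (Fin n) K ⧸ I) (hl : l ∈ quotPart I 1) (j : ℤ) :
    quotPart I j →ₗ[K] quotPart I (j + 1) :=
  (LinearMap.mulLeft K l).restrict (mul_mem_quotPart I hl j)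

/-- The weak Lefschetz property of `S/I`: for some linear form `ℓ ∈ (S/I)_1`, all maps
`×ℓ : (S/I)_j → (S/I)_{j+1}` have maximal rank, i.e. are injective or surjective. -/
def HasWLP (I : Ideal (MvPolynomial (Fin n) K)) : Prop :=
  ∃ (l : MvPolynomial (Fin n) K ⧸ I) (hl : l ∈ quotPart I 1), ∀ j : ℤ,
    Function.Injective (timesLinear I l hl j) ∨ Function.Surjective (timesLinear I l hl j)

/-- `I` is generated in the single degree `d`, i.e. by forms of degree `d`. -/
def GeneratedInDegree (I : Ideal (MvPolynomial (Fin n) K)) (d : ℕ) : Prop :=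
  ∃ T : Set (MvPolynomial (Fin n) K), (∀ f ∈ T, f.IsHomogeneous d) ∧ I = Ideal.span T

/-- The degree `j` part of the graded free module `⨁_k S(-a_k)`, whose `k`-th basis element
has degree `a_k`: the vectors whose `k`-th coordinate is a form of degree `j - a_k`. -/
def freePart (K : Type*) [Field K] (n : ℕ) {r : ℕ} (a : Fin r → ℤ) (j : ℤ) :
    Set (Fin r → MvPolynomial (Fin n) K) :=
  {v | ∀ k, v k ∈ polyPart K n (j - a k)}

/-- A minimal graded free resolution `0 → F_p → ⋯ → F_1 → F_0 → S/I → 0`, where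
`F_i = ⨁_k S(-shift i k)` has finite rank `rank i`, all maps are graded of degree `0`, and
minimality means that the differentials map into `𝔪 F_i`, with `𝔪 = (x_1, …, x_n)`. -/
structure MinimalGradedFreeResolution (I : Ideal (MvPolynomial (Fin n) K)) where
  rank : ℕ → ℕ
  shift : (i : ℕ) → Fin (rank i) → ℤ
  aug : (Fin (rank 0) → MvPolynomial (Fin n) K) →ₗ[MvPolynomial (Fin n) K]
    (MvPolynomial (Fin n) K ⧸ I)
  diff : (i : ℕ) → (Fin (rank (i + 1)) → MvPolynomial (Fin n) K) →ₗ[MvPolynomial (Fin n) K]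
    (Fin (rank i) → MvPolynomial (Fin n) K)
  aug_graded : ∀ j : ℤ, ∀ v ∈ freePart K n (shift 0) j, aug v ∈ quotPart I j
  diff_graded : ∀ (i : ℕ) (j : ℤ), ∀ v ∈ freePart K n (shift (i + 1)) j,
    diff i v ∈ freePart K n (shift i) j
  aug_surjective : Function.Surjective aug
  exact_aug : Function.Exact (diff 0) aug
  exact_diff : ∀ i : ℕ, Function.Exact (diff (i + 1)) (diff i)
  finite_length : ∃ p : ℕ, ∀ i > p, rank i = 0
  minimal : ∀ i : ℕ, LinearMap.range (diff i) ≤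
    Ideal.span (Set.range (MvPolynomial.X : Fin n → MvPolynomial (Fin n) K)) •
      (⊤ : Submodule (MvPolynomial (Fin n) K) (Fin (rank i) → MvPolynomial (Fin n) K))

/-- The graded Betti number `β_{i,j}`: the number of copies of `S(-j)` in `F_i`. -/
def MinimalGradedFreeResolution.betti {I : Ideal (MvPolynomial (Fin n) K)}
    (F : MinimalGradedFreeResolution I) (i : ℕ) (j : ℤ) : ℕ :=
  (Finset.univ.filter fun k : Fin (F.rank i) => F.shift i k = j).card

/-- For `I` generated in degree `d`: the minimal graded free resolution of `S/I` (unique up to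
isomorphism) is linear for `r` steps, i.e. `β_{i,i+j}(S/I) = 0` for `1 ≤ i ≤ r` and `j ≥ d`. -/
def LinearForSteps (I : Ideal (MvPolynomial (Fin n) K)) (d r : ℕ) : Prop :=
  ∃ F : MinimalGradedFreeResolution I,
    ∀ i : ℕ, 1 ≤ i → i ≤ r → ∀ j : ℤ, (d : ℤ) ≤ j → F.betti i (i + j) = 0

/-- Almost linear resolution: linear for `n - 1` steps (no condition if `n ≤ 1`). -/
def HasAlmostLinearResolution (I : Ideal (MvPolynomial (Fin n) K)) (d : ℕ) : Prop :=
  LinearForSteps I d (n - 1)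

end LefschetzAlmostLinear

namespace LefschetzAlmostLinear

open MvPolynomial

variable {K : Type*} [Field K] {n : ℕ}

/-! Write n = m + 1. The form x_0 already works. Below degree d the ideal is zero, so ×x_0 into
those degrees is injective. From degree d on it is surjective, i.e. Tor_0(S/I, S/(x_0)) vanishes
there. To see this, choose N with all x_i^N in I and put J_q = (x_0, x_1^N, …, x_q^N). As I kills
Tor, the sequence 0 → S/J_q(-N) → S/J_q → S/J_{q+1} → 0 makes the connecting map Tor_{q+1}(S/I,
S/J_{q+1}) → Tor_q(S/I, S/J_q), of degree -N, surjective. Hence it suffices that Tor_m(S/I, S/J_m)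
vanishes in degrees D + mN with D ≥ d. There even F_m / J_m F_m is zero: linearity puts the
generators of F_m in degrees < m + d, and S/J_m is zero above degree m(N - 1). The descent is
`exists_sub_diff_mem_powIdeal`; `exists_sub_X_mul_mem` reads off q = 0. -/

/-- The degree `j` component of a polynomial, in the `ℤ`-grading with parts `polyPart K n j`. -/
noncomputable abbrev comp (j : ℤ) :
    MvPolynomial (Fin n) K →ₗ[K] MvPolynomial (Fin n) K :=
  weightedHomogeneousComponent (fun _ : Fin n => (1 : ℤ)) j

theorem comp_mem_polyPart (j : ℤ) (p : MvPolynomial (Fin n) K) : comp j p ∈ polyPart K n j :=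
  weightedHomogeneousComponent_mem _ p j

theorem comp_of_mem {i j : ℤ} {p : MvPolynomial (Fin n) K} (hp : p ∈ polyPart K n i) :
    comp j p = if j = i then p else 0 :=
  weightedHomogeneousComponent_of_mem hp

theorem comp_eq_self {j : ℤ} {p : MvPolynomial (Fin n) K} (hp : p ∈ polyPart K n j) :
    comp j p = p := by
  rw [comp_of_mem hp, if_pos rfl]

theorem weight_one_eq_sum (s : Fin n →₀ ℕ) :
    Finsupp.weight (fun _ : Fin n => (1 : ℤ)) s = ∑ i, (s i : ℤ) := by
  rw [Finsupp.weight_apply, Finsupp.sum_fintype] <;> simp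

theorem sum_eq_of_mem_polyPart {j : ℤ} {p : MvPolynomial (Fin n) K} (hp : p ∈ polyPart K n j)
    {s : Fin n →₀ ℕ} (hs : coeff s p ≠ 0) : ∑ i, (s i : ℤ) = j := by
  rw [← weight_one_eq_sum]
  exact hp hs

theorem eq_zero_of_mem_polyPart_of_neg {j : ℤ} (hj : j < 0) {p : MvPolynomial (Fin n) K}
    (hp : p ∈ polyPart K n j) : p = 0 := by
  ext s
  by_contra hs
  have h := sum_eq_of_mem_polyPart hp hs
  have h' : 0 ≤ ∑ i, (s i : ℤ) := Finset.sum_nonneg fun i _ => by positivity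
  omega

theorem mul_mem_polyPart {i j : ℤ} {p q : MvPolynomial (Fin n) K} (hp : p ∈ polyPart K n i)
    (hq : q ∈ polyPart K n j) : p * q ∈ polyPart K n (i + j) :=
  IsWeightedHomogeneous.mul hp hq

theorem monomial_mem_polyPart (s : Fin n →₀ ℕ) (c : K) :
    monomial s c ∈ polyPart K n (∑ i, (s i : ℤ)) :=
  isWeightedHomogeneous_monomial _ _ _ (weight_one_eq_sum s)

theorem X_pow_mem_polyPart (i : Fin n) (N : ℕ) :
    (X i ^ N : MvPolynomial (Fin n) K) ∈ polyPart K n N := by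
  have h := (isWeightedHomogeneous_X K (fun _ : Fin n => (1 : ℤ)) i).pow N
  rwa [nsmul_one] at h

theorem X_mem_polyPart (i : Fin n) : (X i : MvPolynomial (Fin n) K) ∈ polyPart K n 1 :=
  isWeightedHomogeneous_X K (fun _ : Fin n => (1 : ℤ)) i

theorem mem_polyPart_of_isHomogeneous {d : ℕ} {f : MvPolynomial (Fin n) K}
    (hf : f.IsHomogeneous d) : f ∈ polyPart K n d := by
  intro s hs
  rw [weight_one_eq_sum, ← hf hs, Finsupp.weight_apply, Finsupp.sum_fintype] <;> simp

theorem comp_mul {e : ℤ} {f : MvPolynomial (Fin n) K} (hf : f ∈ polyPart K n e) (j : ℤ)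
    (p : MvPolynomial (Fin n) K) : comp j (f * p) = f * comp (j - e) p := by
  induction p using MvPolynomial.induction_on' with
  | monomial s c =>
    have hs := monomial_mem_polyPart (K := K) s c
    rw [comp_of_mem (mul_mem_polyPart hf hs), comp_of_mem hs]
    by_cases h : j = e + ∑ i, (s i : ℤ)
    · rw [if_pos h, if_pos (by omega)]
    · rw [if_neg h, if_neg (by omega), mul_zero]
  | add p q hp hq => rw [mul_add, map_add, hp, hq, map_add, mul_add]

/-! ### Ideals generated in one degree -/

section Ideals

variable {I : Ideal (MvPolynomial (Fin n) K)} {d : ℕ}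

theorem GeneratedInDegree.comp_mem (hI : GeneratedInDegree I d) {p : MvPolynomial (Fin n) K}
    (hp : p ∈ I) (j : ℤ) : comp j p ∈ I := by
  obtain ⟨T, hT, rfl⟩ := hI
  let := weightedGradedAlgebra K (fun _ : Fin n => (1 : ℤ))
  exact weightedHomogeneousComponent_mem_of_mem K _
    (Ideal.homogeneous_span _ _ fun f hf =>
      ⟨(d : ℤ), mem_polyPart_of_isHomogeneous (hT f hf)⟩) hp j

theorem GeneratedInDegree.eq_zero_of_lt (hI : GeneratedInDegree I d) {j : ℤ} (hj : j < d)
    {p : MvPolynomial (Fin n) K} (hp : p ∈ I) (hpj : p ∈ polyPart K n j) : p = 0 := by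
  obtain ⟨T, hT, rfl⟩ := hI
  rw [← comp_eq_self hpj]
  clear hpj
  induction hp using Submodule.span_induction generalizing j with
  | mem f hf =>
    rw [comp_of_mem (mem_polyPart_of_isHomogeneous (hT f hf)), if_neg hj.ne]
  | zero => simp
  | add p q _ _ hp hq => rw [map_add, hp hj, hq hj, add_zero]
  | smul a p _ hp =>
    induction a using MvPolynomial.induction_on' with
    | monomial s c =>
      have hs : 0 ≤ ∑ i, (s i : ℤ) := Finset.sum_nonneg fun i _ => by positivity
      rw [smul_eq_mul, comp_mul (monomial_mem_polyPart s c), hp (by omega), mul_zero]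
    | add a a' ha ha' => rw [add_smul, map_add, ha, ha', add_zero]

/-- Some power of each variable lies in an ideal with artinian quotient generated by forms. -/
theorem GeneratedInDegree.exists_X_pow_mem (hI : GeneratedInDegree I d)
    [IsArtinianRing (MvPolynomial (Fin n) K ⧸ I)] : ∃ N : ℕ, ∀ i, (X i ^ N) ∈ I := by
  have h (i : Fin n) : ∃ N : ℕ, (X i ^ N) ∈ I := by
    obtain ⟨N, y, hy⟩ := IsArtinian.exists_pow_succ_smul_dvd
      (Ideal.Quotient.mk I (X i)) (1 : MvPolynomial (Fin n) K ⧸ I)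
    obtain ⟨g, rfl⟩ := Ideal.Quotient.mk_surjective y
    rw [smul_eq_mul, smul_eq_mul, mul_one, ← map_pow, ← map_pow, ← map_mul, Ideal.Quotient.eq]
      at hy
    refine ⟨N, ?_⟩
    -- Modulo I, x^N = x^(N+1) g; since x^(N+1) g has no component of degree N, that degree leaves
    -- x^N alone.
    have h := hI.comp_mem hy N
    rw [map_sub, comp_mul (X_pow_mem_polyPart i (N + 1)), comp_eq_self (X_pow_mem_polyPart i N),
      eq_zero_of_mem_polyPart_of_neg (by push_cast; omega) (comp_mem_polyPart _ g), mul_zero,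
      zero_sub, neg_mem_iff] at h
    exact h
  choose N hN using h
  exact ⟨∑ i, N i, fun i => Ideal.pow_mem_of_pow_mem _ (hN i)
    (Finset.single_le_sum (fun _ _ => Nat.zero_le _) (Finset.mem_univ i))⟩

end Ideals

/-! ### The ideals J_q -/

/-- The monomial ideal `(x_i ^ b_i : i ≤ q)`, described by the exponents of its members. -/
def powIdeal (K : Type*) [Field K] {n : ℕ} (b : Fin n → ℕ) (q : ℕ) :
    Ideal (MvPolynomial (Fin n) K) where
  carrier := {p | ∀ s, coeff s p ≠ 0 → ∃ i : Fin n, i.val ≤ q ∧ b i ≤ s i}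
  zero_mem' := by simp
  add_mem' {p p'} hp hp' s hs := by
    by_cases h : coeff s p = 0
    · exact hp' s (by simpa [h] using hs)
    · exact hp s h
  smul_mem' a p hp s hs := by
    classical
    obtain ⟨t, -, u, hu, rfl⟩ := Finset.mem_add.1 (support_mul a p (mem_support_iff.2 hs))
    obtain ⟨i, hi, hb⟩ := hp u (mem_support_iff.1 hu)
    exact ⟨i, hi, hb.trans (by simp)⟩

section PowIdeal

variable {b : Fin n → ℕ} {q : ℕ} {p : MvPolynomial (Fin n) K}

theorem mem_powIdeal :
    p ∈ powIdeal K b q ↔ ∀ s, coeff s p ≠ 0 → ∃ i : Fin n, i.val ≤ q ∧ b i ≤ s i :=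
  Iff.rfl

theorem comp_mem_powIdeal (hp : p ∈ powIdeal K b q) (j : ℤ) : comp j p ∈ powIdeal K b q := by
  classical
  intro s hs
  rw [coeff_weightedHomogeneousComponent] at hs
  exact hp s fun h => hs (by simp [h])

theorem powIdeal_mono {q' : ℕ} (h : q ≤ q') : powIdeal K b q ≤ powIdeal K b q' := fun _ hp s hs =>
  (hp s hs).imp fun _ hi => ⟨hi.1.trans h, hi.2⟩

theorem X_pow_mem_powIdeal (i : Fin n) (hi : i.val ≤ q) : X i ^ b i ∈ powIdeal K b q := by
  classical
  intro s hs
  rw [coeff_X_pow] at hs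
  obtain rfl := (ite_ne_right_iff.1 hs).1
  exact ⟨i, hi, by simp⟩

/-- The generators of J_q do not involve x_i for i > q, so x_i is a nonzerodivisor modulo J_q. -/
theorem mem_powIdeal_of_X_pow_mul_mem (i : Fin n) (hi : q < i.val) (N : ℕ)
    (h : X i ^ N * p ∈ powIdeal K b q) : p ∈ powIdeal K b q := by
  intro s hs
  obtain ⟨k, hk, hb⟩ := h (Finsupp.single i N + s)
    (by rwa [X_pow_eq_monomial, coeff_monomial_mul, one_mul])
  have hki : i ≠ k := fun h => by subst h; omega
  exact ⟨k, hk, by simpa [Finsupp.single_apply, hki] using hb⟩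

theorem exists_sub_X_pow_mul_mem_powIdeal (i : Fin n) (hi : i.val = q + 1)
    (h : p ∈ powIdeal K b (q + 1)) : ∃ a, p - X i ^ b i * a ∈ powIdeal K b q := by
  refine ⟨p.divMonomial (Finsupp.single i (b i)), ?_⟩
  have hp : p - X i ^ b i * p.divMonomial (Finsupp.single i (b i)) =
      p.modMonomial (Finsupp.single i (b i)) := by
    rw [X_pow_eq_monomial, sub_eq_iff_eq_add', divMonomial_add_modMonomial]
  rw [hp]
  intro s hs
  by_cases hle : Finsupp.single i (b i) ≤ s
  · exact absurd (coeff_modMonomial_of_le p hle) hs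
  · rw [coeff_modMonomial_of_not_le p hle] at hs
    obtain ⟨k, hk, hb⟩ := h s hs
    refine ⟨k, ?_, hb⟩
    by_contra hkq
    obtain rfl : k = i := Fin.ext (by omega)
    exact hle (Finsupp.single_le_iff.2 hb)

end PowIdeal

/-- Forms of large degree lie in `(x_0, x_1 ^ N, …, x_m ^ N)`. -/
theorem mem_powIdeal_of_lt_degree {m N : ℕ} {j : ℤ} (hj : (m : ℤ) * (N - 1) < j)
    {p : MvPolynomial (Fin (m + 1)) K} (hp : p ∈ polyPart K (m + 1) j) :
    p ∈ powIdeal K (Fin.cons 1 fun _ => N : Fin (m + 1) → ℕ) m := by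
  intro s hs
  by_contra! h
  have h0 := h 0 (by simp)
  have hs' := sum_eq_of_mem_polyPart hp hs
  rw [Fin.sum_univ_succ] at hs'
  have hle : ∑ i : Fin m, (s i.succ : ℤ) ≤ ∑ i : Fin m, ((N : ℤ) - 1) :=
    Finset.sum_le_sum fun i _ => by
      have := h i.succ (by simp)
      simp only [Fin.cons_succ] at this
      omega
  simp only [Finset.sum_const, Finset.card_univ, Fintype.card_fin, nsmul_eq_mul] at hle
  simp only [Fin.cons_zero] at h0
  omega

theorem exists_eq_X_mul_of_mem_powIdeal {m N : ℕ} {p : MvPolynomial (Fin (m + 1)) K}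
    (hp : p ∈ powIdeal K (Fin.cons 1 fun _ => N : Fin (m + 1) → ℕ) 0) : ∃ a, p = X 0 * a := by
  have h : p ∈ Ideal.span {(X 0 : MvPolynomial (Fin (m + 1)) K)} := by
    rw [← Set.image_singleton, mem_ideal_span_X_image]
    intro s hs
    obtain ⟨i, hi, hb⟩ := hp s (mem_support_iff.1 hs)
    obtain rfl : i = 0 := Fin.ext (Nat.le_zero.1 hi)
    rw [Fin.cons_zero] at hb
    exact ⟨0, rfl, by omega⟩
  exact Ideal.mem_span_singleton.1 h

/-! ### Graded free modules -/

theorem smul_eq_mk_mul {I : Ideal (MvPolynomial (Fin n) K)} (f : MvPolynomial (Fin n) K)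
    (y : MvPolynomial (Fin n) K ⧸ I) : f • y = Ideal.Quotient.mk I f * y := by
  obtain ⟨g, rfl⟩ := Ideal.Quotient.mk_surjective y
  rfl

/-- A linear map from a finite free module lifts along an exact pair. -/
theorem exists_lift_of_exact {R : Type*} [CommRing R] {r : ℕ} {M N P : Type*} [AddCommGroup M]
    [AddCommGroup N] [AddCommGroup P] [Module R M] [Module R N] [Module R P] {f : M →ₗ[R] N}
    {g : N →ₗ[R] P} (hfg : Function.Exact f g) (φ : (Fin r → R) →ₗ[R] N)
    (hφ : ∀ v, g (φ v) = 0) : ∃ ψ : (Fin r → R) →ₗ[R] M, ∀ v, f (ψ v) = φ v := by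
  choose w hw using fun k => (hfg (φ (Pi.basisFun R (Fin r) k))).1 (hφ _)
  refine ⟨(Pi.basisFun R (Fin r)).constr R w, fun v => ?_⟩
  have h : f ∘ₗ (Pi.basisFun R (Fin r)).constr R w = φ :=
    (Pi.basisFun R (Fin r)).ext fun k => by
      simp only [LinearMap.comp_apply, Module.Basis.constr_basis, hw]
  exact LinearMap.congr_fun h v

/-- The coordinatewise projection of `⨁_k S(-a_k)` to its degree `j` part. -/
noncomputable def freeComp {r : ℕ} (a : Fin r → ℤ) (j : ℤ) :
    (Fin r → MvPolynomial (Fin n) K) →ₗ[K] (Fin r → MvPolynomial (Fin n) K) :=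
  LinearMap.pi fun k => comp (j - a k) ∘ₗ LinearMap.proj k

section FreeComp

variable {r : ℕ} {a : Fin r → ℤ}

@[simp]
theorem freeComp_apply (j : ℤ) (v : Fin r → MvPolynomial (Fin n) K) (k : Fin r) :
    freeComp a j v k = comp (j - a k) (v k) :=
  rfl

theorem freeComp_mem_freePart (j : ℤ) (v : Fin r → MvPolynomial (Fin n) K) :
    freeComp a j v ∈ freePart K n a j :=
  fun k => comp_mem_polyPart _ (v k)

theorem freeComp_of_mem {i j : ℤ} {v : Fin r → MvPolynomial (Fin n) K}
    (hv : v ∈ freePart K n a i) : freeComp a j v = if j = i then v else 0 := by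
  ext1 k
  rw [freeComp_apply, comp_of_mem (hv k)]
  by_cases h : j = i
  · simp [h]
  · rw [if_neg (by omega), if_neg h, Pi.zero_apply]

/-- The elements of a graded free module are spanned by homogeneous ones. -/
theorem freePart_induction {motive : (Fin r → MvPolynomial (Fin n) K) → Prop}
    (add : ∀ v w, motive v → motive w → motive (v + w))
    (mem : ∀ j, ∀ v ∈ freePart K n a j, motive v) (v : Fin r → MvPolynomial (Fin n) K) :
    motive v := by
  have zero : motive 0 := mem 0 0 fun k => Submodule.zero_mem _
  rw [← Finset.univ_sum_single v]
  refine Finset.sum_induction _ motive add zero fun k _ => ?_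
  induction v k using MvPolynomial.induction_on' with
  | monomial s c =>
    refine mem (∑ i, (s i : ℤ) + a k) _ fun l => ?_
    by_cases h : l = k
    · subst h
      rw [Pi.single_eq_same, add_sub_cancel_right]
      exact monomial_mem_polyPart s c
    · rw [Pi.single_eq_of_ne h]
      exact Submodule.zero_mem _
  | add p q hp hq =>
    rw [Pi.single_add]
    exact add _ _ hp hq

theorem freeComp_smul {e : ℤ} {f : MvPolynomial (Fin n) K} (hf : f ∈ polyPart K n e) (j : ℤ)
    (v : Fin r → MvPolynomial (Fin n) K) : freeComp a j (f • v) = f • freeComp a (j - e) v := by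
  ext1 k
  rw [freeComp_apply, Pi.smul_apply, smul_eq_mul, comp_mul hf, Pi.smul_apply, freeComp_apply,
    smul_eq_mul, sub_right_comm]

/-- A graded map between graded free modules commutes with the projections. -/
theorem map_freeComp {r' : ℕ} {a' : Fin r' → ℤ}
    (φ : (Fin r → MvPolynomial (Fin n) K) →ₗ[MvPolynomial (Fin n) K]
      (Fin r' → MvPolynomial (Fin n) K))
    (hφ : ∀ j : ℤ, ∀ v ∈ freePart K n a j, φ v ∈ freePart K n a' j) (j : ℤ)
    (v : Fin r → MvPolynomial (Fin n) K) : φ (freeComp a j v) = freeComp a' j (φ v) := by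
  induction v using freePart_induction (a := a) with
  | add v w hv hw => simp only [map_add, hv, hw]
  | mem i v hv =>
    rw [freeComp_of_mem hv, freeComp_of_mem (hφ i v hv)]
    split_ifs <;> simp

end FreeComp

/-! ### Homotopies and the descent on Tor -/

namespace MinimalGradedFreeResolution

variable {I : Ideal (MvPolynomial (Fin n) K)} (F : MinimalGradedFreeResolution I)

/-- Multiplication by an element of `I` is null-homotopic on a resolution of `S/I`. -/
theorem exists_homotopy {f : MvPolynomial (Fin n) K} (hf : f ∈ I) (i : ℕ) :
    ∃ (h : (Fin (F.rank i) → MvPolynomial (Fin n) K) →ₗ[MvPolynomial (Fin n) K]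
        (Fin (F.rank (i + 1)) → MvPolynomial (Fin n) K))
      (h' : (Fin (F.rank (i + 1)) → MvPolynomial (Fin n) K) →ₗ[MvPolynomial (Fin n) K]
        (Fin (F.rank (i + 2)) → MvPolynomial (Fin n) K)),
      -- In position 0 the homotopy has no second term, because F_{-1} = 0.
      (i = 0 → ∀ v, F.diff i (h v) = f • v) ∧
      ∀ v, F.diff (i + 1) (h' v) + h (F.diff i v) = f • v := by
  have step (i : ℕ) (h : (Fin (F.rank i) → MvPolynomial (Fin n) K) →ₗ[MvPolynomial (Fin n) K]
        (Fin (F.rank (i + 1)) → MvPolynomial (Fin n) K))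
      (hh : ∀ v, F.diff i (h (F.diff i v)) = f • F.diff i v) :
      ∃ h' : (Fin (F.rank (i + 1)) → MvPolynomial (Fin n) K) →ₗ[MvPolynomial (Fin n) K]
        (Fin (F.rank (i + 2)) → MvPolynomial (Fin n) K),
      ∀ v, F.diff (i + 1) (h' v) + h (F.diff i v) = f • v := by
    obtain ⟨h', hh'⟩ := exists_lift_of_exact (F.exact_diff i)
      (f • LinearMap.id - h ∘ₗ F.diff i) fun v => by simp [hh]
    exact ⟨h', fun v => by simp [hh']⟩
  induction i with
  | zero =>
    obtain ⟨h, hh⟩ := exists_lift_of_exact F.exact_aug (f • LinearMap.id) fun v => by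
      rw [LinearMap.smul_apply, map_smul, LinearMap.id_apply, smul_eq_mk_mul, Ideal.Quotient.eq_zero_iff_mem.2 hf, zero_mul]
    obtain ⟨h', hh'⟩ := step 0 h fun v => by rw [hh]; rfl
    exact ⟨h, h', fun _ v => hh v, hh'⟩
  | succ i ih =>
    obtain ⟨h, h', -, hh⟩ := ih
    obtain ⟨h'', hh''⟩ := step (i + 1) h' fun v => by
      have h0 : F.diff i (F.diff (i + 1) v) = 0 := (F.exact_diff i).apply_apply_eq_zero v
      simpa [h0] using hh (F.diff (i + 1) v)
    exact ⟨h', h'', fun h => absurd h (Nat.succ_ne_zero i), hh''⟩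

/-- The vector `z ∈ F_i` is a cycle of the complex `F / J F`, with `F_{-1} = 0`. -/
def IsCycleMod (J : Ideal (MvPolynomial (Fin n) K)) :
    (i : ℕ) → (Fin (F.rank i) → MvPolynomial (Fin n) K) → Prop
  | 0, _ => True
  | i + 1, z => ∀ k, F.diff i z k ∈ J

/-- The homology of `F / J F`, which is `Tor(S/I, S/J)`, is killed by `I`. -/
theorem IsCycleMod.exists_smul_sub_mem {J : Ideal (MvPolynomial (Fin n) K)} {i : ℕ}
    {z : Fin (F.rank i) → MvPolynomial (Fin n) K} (hz : F.IsCycleMod J i z)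
    {f : MvPolynomial (Fin n) K} (hf : f ∈ I) : ∃ w, ∀ k, (f • z - F.diff i w) k ∈ J := by
  cases i with
  | zero =>
    obtain ⟨h, -, hh, -⟩ := F.exists_homotopy hf 0
    exact ⟨h z, fun k => by simp [hh rfl z]⟩
  | succ i =>
    obtain ⟨h, h', -, hh⟩ := F.exists_homotopy hf i
    refine ⟨h' z, fun k => ?_⟩
    rw [← hh z, add_sub_cancel_left]
    exact Ideal.map_pi J _ hz h k

/-- If the `m`-th step of the resolution is linear, then in large degrees the complex `F / J F`,
with `J = (x_0, x_1 ^ N, …, x_q ^ N)` and `q ≤ m`, has no homology in position `q`. -/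
theorem exists_sub_diff_mem_powIdeal {m d N q : ℕ} {I : Ideal (MvPolynomial (Fin (m + 1)) K)}
    (F : MinimalGradedFreeResolution I) (hshift : ∀ k, F.shift m k < m + d)
    (hN : ∀ i, (X i ^ N) ∈ I) {D : ℤ} (hD : d ≤ D) (hq : q ≤ m)
    {z : Fin (F.rank q) → MvPolynomial (Fin (m + 1)) K}
    (hz : z ∈ freePart K (m + 1) (F.shift q) (D + q * N))
    (hcycle : F.IsCycleMod (powIdeal K (Fin.cons 1 fun _ => N) q) q z) :
    ∃ u, ∀ k, (z - F.diff q u) k ∈ powIdeal K (Fin.cons 1 fun _ => N) q := by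
  induction hq using Nat.decreasingInduction with
  | self =>
    refine ⟨0, fun k => ?_⟩
    rw [map_zero, sub_zero]
    refine mem_powIdeal_of_lt_degree ?_ (hz k)
    linarith [hshift k]
  | of_succ q hq ih =>
    set b : Fin (m + 1) → ℕ := Fin.cons 1 fun _ => N
    let x : Fin (m + 1) := ⟨q + 1, by omega⟩
    let y : MvPolynomial (Fin (m + 1)) K := X x ^ N
    -- The connecting map run backwards: y z ≡ ∂w modulo J_q, so w is a cycle modulo J_{q+1}, to
    -- which the induction hypothesis applies.
    have hbx : b x = N := rfl
    obtain ⟨w₀, hw₀⟩ := hcycle.exists_smul_sub_mem F (hN x)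
    let w := freeComp (F.shift (q + 1)) (D + q * N + N) w₀
    have hw (k : Fin (F.rank q)) : (y • z - F.diff q w) k ∈ powIdeal K b q := by
      have h := comp_mem_powIdeal (hw₀ k) (D + q * N + N - F.shift q k)
      have h' : freeComp (F.shift q) (D + q * N + N) (y • z - F.diff q w₀) =
          y • z - F.diff q w := by
        rw [map_sub, freeComp_smul (X_pow_mem_polyPart x N), add_sub_cancel_right,
          freeComp_of_mem hz, if_pos rfl, map_freeComp _ (F.diff_graded q)]
      rwa [← freeComp_apply, h'] at h
    have hxz (k : Fin (F.rank q)) : (y • z) k ∈ powIdeal K b (q + 1) :=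
      Ideal.mul_mem_right _ _ (by
        have h := X_pow_mem_powIdeal (K := K) (b := b) x le_rfl
        rwa [hbx] at h)
    obtain ⟨u, hu⟩ := ih (z := w)
      (by
        rw [Nat.cast_succ, add_one_mul, ← add_assoc]
        exact freeComp_mem_freePart _ w₀)
      fun k => by
        have h := sub_mem (hxz k) (powIdeal_mono (Nat.le_succ q) (hw k))
        rwa [← Pi.sub_apply, sub_sub_cancel] at h
    -- From w ≡ ∂u + y v modulo J_q, applying ∂ gives y z ≡ y ∂v; then y is cancelled.
    choose v hv using fun k => exists_sub_X_pow_mul_mem_powIdeal x rfl (hu k)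
    refine ⟨v, fun k => mem_powIdeal_of_X_pow_mul_mem x (Nat.lt_succ_self q) N ?_⟩
    have h := add_mem (hw k) (Ideal.map_pi _ (w - F.diff (q + 1) u - y • v)
      hv (F.diff q) k)
    have h0 : F.diff q (F.diff (q + 1) u) = 0 := (F.exact_diff q).apply_apply_eq_zero u
    rw [map_sub, map_sub, h0, sub_zero, map_smul, ← Pi.add_apply, sub_add_sub_cancel,
      ← smul_sub] at h
    exact h

/-- If the `m`-th step of the resolution is linear, then multiplication by `x_0` on `S/I` is
surjective in degrees `≥ d`. -/
theorem exists_sub_X_mul_mem {m d N : ℕ} {I : Ideal (MvPolynomial (Fin (m + 1)) K)}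
    (F : MinimalGradedFreeResolution I) (hI : GeneratedInDegree I d)
    (hshift : ∀ k, F.shift m k < m + d)
    (hN : ∀ i, (X i ^ N) ∈ I) {D : ℤ} (hD : d ≤ D) {f : MvPolynomial (Fin (m + 1)) K}
    (hf : f ∈ polyPart K (m + 1) D) : ∃ g ∈ polyPart K (m + 1) (D - 1), f - X 0 * g ∈ I := by
  -- The augmentation commutes with taking degree D parts, so f has a preimage homogeneous of degree
  -- D.
  have haug (v) : ∃ p, F.aug v = Ideal.Quotient.mk I p ∧
      F.aug (freeComp (F.shift 0) D v) = Ideal.Quotient.mk I (comp D p) := by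
    induction v using freePart_induction (a := F.shift 0) with
    | add v w hv hw =>
      obtain ⟨p, hp, hp'⟩ := hv
      obtain ⟨p', hq, hq'⟩ := hw
      exact ⟨p + p', by rw [map_add, hp, hq, map_add],
        by rw [map_add, map_add, hp', hq', map_add, map_add]⟩
    | mem i v hv =>
      obtain ⟨p, hp, hpv⟩ := F.aug_graded i v hv
      refine ⟨p, hpv.symm, ?_⟩
      rw [freeComp_of_mem hv, comp_of_mem hp]
      split_ifs
      · exact hpv.symm
      · rw [map_zero, map_zero]
  obtain ⟨v, hv⟩ := F.aug_surjective (Ideal.Quotient.mk I f)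
  obtain ⟨p, hp, hpD⟩ := haug v
  have hfp : F.aug (freeComp (F.shift 0) D v) = Ideal.Quotient.mk I f := by
    have h := hI.comp_mem (Ideal.Quotient.eq.1 (hp.symm.trans hv)) D
    rw [map_sub, comp_eq_self hf] at h
    rw [hpD]
    exact Ideal.Quotient.eq.2 h
  obtain ⟨u, hu⟩ := F.exists_sub_diff_mem_powIdeal hshift hN hD (Nat.zero_le m)
    (z := freeComp (F.shift 0) D v) (by simpa using freeComp_mem_freePart D v) trivial
  choose a ha using fun k => exists_eq_X_mul_of_mem_powIdeal (hu k)
  have ha' : freeComp (F.shift 0) D v - F.diff 0 u = (X 0 : MvPolynomial (Fin (m + 1)) K) • a :=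
    funext ha
  obtain ⟨g, hg⟩ := Ideal.Quotient.mk_surjective (F.aug a)
  refine ⟨comp (D - 1) g, comp_mem_polyPart _ _, ?_⟩
  have h : f - X 0 * g ∈ I := by
    rw [← Ideal.Quotient.eq, map_mul, hg, ← hfp]
    have h := congrArg F.aug ha'
    rw [map_sub, F.exact_aug.apply_apply_eq_zero, sub_zero, map_smul, smul_eq_mk_mul] at h
    exact h
  have h' := hI.comp_mem h D
  rwa [map_sub, comp_eq_self hf, comp_mul (X_mem_polyPart 0)] at h'

end MinimalGradedFreeResolution

/-! ### The weak Lefschetz property -/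

theorem timesLinear_injective_of_forall {I : Ideal (MvPolynomial (Fin n) K)}
    {x : MvPolynomial (Fin n) K} (hx : Ideal.Quotient.mk I x ∈ quotPart I 1) {j : ℤ}
    (h : ∀ f ∈ polyPart K n j, x * f ∈ I → f ∈ I) :
    Function.Injective (timesLinear I (Ideal.Quotient.mk I x) hx j) := by
  rw [injective_iff_map_eq_zero]
  rintro ⟨_, f, hf, rfl⟩ h0
  have h1 : Ideal.Quotient.mk I x * Ideal.Quotient.mk I f = 0 := congrArg Subtype.val h0
  rw [← map_mul, Ideal.Quotient.eq_zero_iff_mem] at h1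
  exact Subtype.ext (Ideal.Quotient.eq_zero_iff_mem.2 (h f hf h1))

theorem timesLinear_surjective_of_forall {I : Ideal (MvPolynomial (Fin n) K)}
    {x : MvPolynomial (Fin n) K} (hx : Ideal.Quotient.mk I x ∈ quotPart I 1) {j : ℤ}
    (h : ∀ f ∈ polyPart K n (j + 1), ∃ g ∈ polyPart K n j, f - x * g ∈ I) :
    Function.Surjective (timesLinear I (Ideal.Quotient.mk I x) hx j) := by
  rintro ⟨_, f, hf, rfl⟩
  obtain ⟨g, hg, hfg⟩ := h f hf
  refine ⟨⟨_, g, hg, rfl⟩, Subtype.ext ?_⟩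
  have h1 := Ideal.Quotient.eq.2 hfg
  rw [map_mul] at h1
  exact h1.symm

end LefschetzAlmostLinear

open LefschetzAlmostLinear MvPolynomial in
theorem mainTheorem8 {K : Type*} [Field K] [CharZero K] {n : ℕ}
    (I : Ideal (MvPolynomial (Fin n) K)) (d : ℕ)
    (hartinian : IsArtinianRing (MvPolynomial (Fin n) K ⧸ I))
    (hgen : LefschetzAlmostLinear.GeneratedInDegree I d)
    (hlin : LefschetzAlmostLinear.HasAlmostLinearResolution I d) :
    LefschetzAlmostLinear.HasWLP I := by
  rcases n with - | m
  · refine ⟨Ideal.Quotient.mk I 0, ⟨0, Submodule.zero_mem _, rfl⟩, fun j => ?_⟩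
    have h0 {i : ℤ} (hi : i ≠ 0) {f : MvPolynomial (Fin 0) K} (hf : f ∈ polyPart K 0 i) :
        f = 0 := by
      ext s
      by_contra hs
      exact hi (sum_eq_of_mem_polyPart hf hs).symm
    by_cases hj : j = 0
    · refine Or.inr (timesLinear_surjective_of_forall _ fun f hf => ⟨0, Submodule.zero_mem _, ?_⟩)
      rw [h0 (by omega) hf]
      simp
    · refine Or.inl (timesLinear_injective_of_forall _ fun f hf _ => ?_)
      rw [h0 hj hf]
      exact Submodule.zero_mem _
  · refine ⟨Ideal.Quotient.mk I (X 0), ⟨X 0, X_mem_polyPart 0, rfl⟩, fun j => ?_⟩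
    -- The case j < 0 matters for d = 0: surjectivity onto degree 0 may fail, but the source is
    -- zero.
    by_cases hj : j + 1 < d ∨ j < 0
    · refine Or.inl (timesLinear_injective_of_forall _ fun f hf hxf => ?_)
      have hf0 : f = 0 := by
        rcases hj with hj | hj
        · have h := hgen.eq_zero_of_lt hj hxf (add_comm j 1 ▸ mul_mem_polyPart (X_mem_polyPart 0) hf)
          exact (mul_eq_zero.1 h).resolve_left (X_ne_zero 0)
        · exact eq_zero_of_mem_polyPart_of_neg hj hf
      rw [hf0]
      exact Submodule.zero_mem _
    · push Not at hj
      refine Or.inr (timesLinear_surjective_of_forall _ fun f hf => ?_)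
      -- In one variable the linearity condition is empty, but x_0 divides every form of positive
      -- degree.
      rcases Nat.eq_zero_or_pos m with rfl | hm
      · obtain ⟨a, ha⟩ := exists_eq_X_mul_of_mem_powIdeal (N := 0)
          (mem_powIdeal_of_lt_degree (by push_cast; omega) hf)
        have h := comp_mul (X_mem_polyPart 0) (j + 1) a
        rw [← ha, comp_eq_self hf, add_sub_cancel_right] at h
        refine ⟨comp j a, comp_mem_polyPart j a, ?_⟩
        rw [← h, sub_self]
        exact Submodule.zero_mem _
      · obtain ⟨F, hF⟩ := hlin
        obtain ⟨N, hN⟩ := hgen.exists_X_pow_mem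
        have hshift (k) : F.shift m k < m + d := by
          by_contra! hk
          have h := hF m hm le_rfl (F.shift m k - m) (by omega)
          rw [MinimalGradedFreeResolution.betti, Finset.card_eq_zero] at h
          exact Finset.notMem_empty k (h ▸ by simp)
        obtain ⟨g, hg, hfg⟩ := F.exists_sub_X_mul_mem hgen hshift hN (by omega) hf
        exact ⟨g, by simpa using hg, hfg⟩
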